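/- A binary linear code $C \le \mathbb{F}_2^{n}$ is self-dual if it equals its dual under the standard dot product; its automorphism group $\mathrm{Aut}(C)$ is the group of all permutations of the $n$ coordinates that map $C$ to itself. A self-dual code of length $n=24m$ is called extremal if its minimum distance is $4m+4$. For an odd prime $p$ let $s(p)$ be the smallest positive integer $s$ with $p \mid 2^s-1$. A permutation is of type $2p$-$(\alpha,\beta,\gamma;\delta)$ if it has order $2p$ and has exactly $\alpha$ $2$-cycles, $\beta$ $p$-cycles, $\gamma$ $2p$-cycles and $\delta$ fixed points. Let $C$ be an extremal binary self-dual code of length $n=24m$, let $p$ be an odd prime, and let $g \in \mathrm{Aut}(C)$ be of type $2p$-$(w,0,x;0)$. If $s(p)$ is even and $w$ is odd, then $p \le \frac{n}{4}-1$. -/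

import Mathlib

/-- Binary linear codes of length `n`: subspaces of `𝔽₂ⁿ`. -/
abbrev BinaryCode (n : ℕ) : Type := Submodule (ZMod 2) (Fin n → ZMod 2)

namespace BinaryCode

variable {n : ℕ}

/-- The dual code `C^⊥` with respect to the standard dot product on `𝔽₂ⁿ`. -/
def dual (C : BinaryCode n) : BinaryCode n where
  carrier := {v | ∀ c ∈ C, v ⬝ᵥ c = 0}
  add_mem' := by
    intro a b ha hb c hc
    rw [add_dotProduct, ha c hc, hb c hc, add_zero]
  zero_mem' := by
    intro c _
    exact zero_dotProduct c
  smul_mem' := by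
    intro r a ha c hc
    rw [smul_dotProduct, ha c hc, smul_zero]

/-- A code is self-dual if it equals its dual. -/
def IsSelfDual (C : BinaryCode n) : Prop := C = C.dual

/-- `C` has minimum distance `d`: the least Hamming distance between two distinct codewords. -/
def HasMinDist (C : BinaryCode n) (d : ℕ) : Prop :=
  IsLeast {k : ℕ | ∃ a ∈ C, ∃ b ∈ C, a ≠ b ∧ hammingDist a b = k} d

/-- The automorphism group `Aut(C)`: the permutations of the coordinates that preserve `C`. -/
def autGroup (C : BinaryCode n) : Subgroup (Equiv.Perm (Fin n)) where
  carrier := {g | ∀ c : Fin n → ZMod 2, c ∘ g ∈ C ↔ c ∈ C}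
  mul_mem' := by
    intro a b ha hb c
    exact (hb (c ∘ a)).trans (ha c)
  one_mem' := by
    intro c
    exact Iff.rfl
  inv_mem' := by
    intro a ha c
    have h := ha (c ∘ ⇑a⁻¹)
    have e : (c ∘ ⇑a⁻¹) ∘ ⇑a = c := by
      funext i
      simp
    rw [e] at h
    exact h.symm

/-- Extremal self-dual codes of length `24m`: self-dual codes with parameters
`[24m, 12m, 4m+4]` (the dimension `12m` is forced by self-duality). -/
structure IsExtremalSelfDual {m : ℕ} (C : BinaryCode (24 * m)) : Prop where
  selfDual : C.IsSelfDual
  minDist : C.HasMinDist (4 * m + 4)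

end BinaryCode

/-- `s(p)`: the smallest positive integer `s` with `p ∣ 2 ^ s - 1`. -/
noncomputable def sOrder (p : ℕ) : ℕ := sInf {s : ℕ | 0 < s ∧ p ∣ 2 ^ s - 1}

/-- The permutation `g` has type `2p`-`(α, β, γ; δ)`: it has order `2p`, with `α` 2-cycles,
`β` `p`-cycles, `γ` `2p`-cycles and `δ` fixed points. -/
structure HasTypeTwoP {n : ℕ} (g : Equiv.Perm (Fin n)) (p α β γ δ : ℕ) : Prop where
  order_eq : orderOf g = 2 * p
  two_cycles : g.cycleType.count 2 = α
  p_cycles : g.cycleType.count p = β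
  two_p_cycles : g.cycleType.count (2 * p) = γ
  fixed_points : (Function.fixedPoints g).ncard = δ

/-! Counting coordinates gives `12 * m = w + p * x`, so `x` is odd. If `x ≥ 3`, the length is at
least `6 * p + 2` and the bound follows. The case `x = 1` is impossible: evenness of `sOrder p`
makes `-1` a power of `2` mod `p`, so Frobenius realises `X ↦ X⁻¹` on `𝔽₂[ℤ/p]`, and vanishing
autocorrelation of `V` reads `V ^ (2 ^ k + 1) = 0`, forcing `V = 0`. Self-orthogonality supplies
this vanishing (`pair_sum_eq`): every codeword has equal sums over all pairs `{y, g ^ p y}` of the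
long cycle. The indicator of two such pairs is then orthogonal to `C`, hence a codeword of weight at
most `4 < 4 * m + 4`. -/

theorem exists_dvd_two_pow_add_one_of_even_sOrder {p : ℕ} (hp : p.Prime) (hp2 : Odd p)
    (hs : Even (sOrder p)) : ∃ k, 0 < k ∧ p ∣ 2 ^ k + 1 := by
  have hne : {s : ℕ | 0 < s ∧ p ∣ 2 ^ s - 1}.Nonempty := by
    refine ⟨p.totient, Nat.totient_pos.2 hp.pos, ?_⟩
    have h : 2 ^ p.totient ≡ 1 [MOD p] :=
      Nat.ModEq.pow_totient (Nat.coprime_two_left.2 hp2)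
    exact (Nat.modEq_iff_dvd' Nat.one_le_two_pow).1 h.symm
  obtain ⟨hpos, hdvd⟩ := Nat.sInf_mem hne
  obtain ⟨k, hk⟩ := hs
  change 0 < sOrder p at hpos
  change p ∣ 2 ^ sOrder p - 1 at hdvd
  have hk0 : 0 < k := by omega
  refine ⟨k, hk0, ?_⟩
  have hfac : 2 ^ sOrder p - 1 = (2 ^ k + 1) * (2 ^ k - 1) := by
    rw [hk, pow_add]
    simpa using Nat.mul_self_sub_mul_self_eq (2 ^ k) 1
  rw [hfac] at hdvd
  -- Minimality of `sOrder p = 2k` rules out the factor `2 ^ k - 1`.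
  refine (hp.dvd_mul.1 hdvd).resolve_right fun h => ?_
  have : sOrder p ≤ k := Nat.sInf_le ⟨hk0, h⟩
  omega

/-- If `-1` is a power of `2` modulo `p`, a binary sequence of period `p` whose periodic
autocorrelation vanishes is zero. -/
theorem eq_zero_of_autocorrelation_eq_zero {p k : ℕ} [NeZero p] (hk : 0 < k)
    (hpk : p ∣ 2 ^ k + 1) (v : ZMod p → ZMod 2) (hv : ∀ j, ∑ i, v i * v (i + j) = 0) :
    v = 0 := by
  have hkp : ((2 ^ k : ℕ) : ZMod p) = -1 := by
    have := (ZMod.natCast_eq_zero_iff (2 ^ k + 1) p).2 hpk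
    rw [Nat.cast_add, Nat.cast_one] at this
    exact eq_neg_of_add_eq_zero_left this
  let A := AddMonoidAlgebra (ZMod 2) (ZMod p)
  have : CharP A 2 := charP_of_injective_algebraMap (algebraMap (ZMod 2) A).injective 2
  have hfrob (r : ℕ) (u : ZMod 2) : u ^ 2 ^ r = u := by
    induction r with
    | zero => simp
    | succ r ih => rw [pow_succ, pow_mul, ih, ZMod.pow_card]
  let V : A := ∑ i, AddMonoidAlgebra.single i (v i)
  have hV (r : ℕ) : V ^ 2 ^ r = ∑ i, AddMonoidAlgebra.single (((2 ^ r : ℕ) : ZMod p) * i) (v i) := by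
    simp only [V]
    rw [sum_pow_char_pow]
    refine Finset.sum_congr rfl fun i _ => ?_
    rw [AddMonoidAlgebra.single_pow, hfrob, nsmul_eq_mul]
  have hmul : V ^ (2 ^ k + 1) = 0 := by
    rw [pow_succ, hV k, hkp]
    simp only [V]
    rw [Finset.sum_mul]
    have h1 (i : ZMod p) : AddMonoidAlgebra.single (-1 * i) (v i) *
        ∑ j, AddMonoidAlgebra.single j (v j) =
        ∑ j, (AddMonoidAlgebra.single j (v i * v (i + j)) : A) := by
      rw [Finset.mul_sum, ← Equiv.sum_comp (Equiv.addLeft i)]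
      refine Finset.sum_congr rfl fun j _ => ?_
      rw [AddMonoidAlgebra.single_mul_single]
      simp
    rw [Finset.sum_congr rfl fun i _ => h1 i, Finset.sum_comm]
    refine Finset.sum_eq_zero fun j _ => ?_
    rw [← AddMonoidAlgebra.single_zero (R := ZMod 2) j, ← hv j]
    exact (map_sum (AddMonoidAlgebra.singleAddHom j) _ _).symm
  -- Inversion applied twice is the identity, so `V` is a power of itself with exponent at least `2
  -- ^ k + 1`, hence zero.
  have hid : V ^ 2 ^ (2 * k) = V := by
    rw [hV (2 * k), two_mul, pow_add, Nat.cast_mul, hkp]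
    simp [V]
  have hV0 : V = 0 := by
    rw [← hid]
    refine pow_eq_zero_of_le ?_ hmul
    have : 2 ^ 1 ≤ 2 ^ k := Nat.pow_le_pow_right two_pos hk
    rw [two_mul, pow_add]
    nlinarith
  funext i
  have hcoeff : V.coeff i = v i := by
    change (∑ j, AddMonoidAlgebra.single j (v j) : AddMonoidAlgebra _ _).coeff i = _
    rw [AddMonoidAlgebra.coeff_sum, Finsupp.finsetSum_apply]
    simp [Finsupp.single_apply]
  rw [← hcoeff, hV0]
  rfl

/-! ### Self-dual codes invariant under a permutation with one long cycle -/

namespace BinaryCode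

variable {n : ℕ} {C : BinaryCode n} {g : Equiv.Perm (Fin n)}

theorem comp_pow_mem (hg : g ∈ C.autGroup) (k : ℕ) {c : Fin n → ZMod 2} (hc : c ∈ C) :
    c ∘ ⇑(g ^ k) ∈ C :=
  (pow_mem hg k c).2 hc

theorem IsSelfDual.dotProduct_eq_zero (hC : C.IsSelfDual) {a b : Fin n → ZMod 2}
    (ha : a ∈ C) (hb : b ∈ C) : a ⬝ᵥ b = 0 := by
  rw [hC] at ha
  exact ha b hb

theorem IsSelfDual.mem_of_forall (hC : C.IsSelfDual) {a : Fin n → ZMod 2}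
    (ha : ∀ c ∈ C, a ⬝ᵥ c = 0) : a ∈ C := by
  rw [hC]
  exact ha

/-- Suppose `g` acts on `s` as a single `2p`-cycle and has order at most `2` elsewhere, and `-1` is
a power of `2` modulo `p`. Then the sum of a codeword of an invariant self-dual code over the pairs
`{y, g ^ p y}`, `y ∈ s`, does not depend on the pair. -/
theorem IsSelfDual.pair_sum_eq (hC : C.IsSelfDual) (hg : g ∈ C.autGroup) {p k : ℕ} (hp : Odd p)
    (hk : 0 < k) (hpk : p ∣ 2 ^ k + 1) {s : Finset (Fin n)} (hs : g.IsCycleOn s)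
    (hcard : s.card = 2 * p) (hfix : ∀ y ∉ s, (g ^ 2) y = y) {o : Fin n} (ho : o ∈ s)
    {c : Fin n → ZMod 2} (hc : c ∈ C) :
    c o + c ((g ^ p) o) = c (g o) + c ((g ^ (p + 1)) o) := by
  have : NeZero p := ⟨hp.pos.ne'⟩
  have hodd : (p : ZMod 2) = 1 := ZMod.natCast_eq_one_iff_odd.2 hp
  have htwo (u : ZMod 2) : u + u = 0 := CharTwo.add_self_eq_zero u
  have hper (k : ℕ) : (g ^ (k + p + p)) o = (g ^ k) o := by
    rw [hs.pow_apply_eq_pow_apply ho, hcard, add_assoc, ← two_mul]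
    simp [Nat.ModEq]
  let α : ℕ → ZMod 2 := fun k => c ((g ^ k) o) + c ((g ^ (k + p)) o)
  have hα : Function.Periodic α p := by
    intro k
    simp only [α]
    rw [hper, add_comm]
  let a : ZMod p → ZMod 2 := fun i => α i.val
  have ha (k : ℕ) : a k = α k := by
    simp only [a]
    rw [ZMod.val_natCast, hα.map_mod_nat]
  have hsum (f : ZMod p → ZMod 2) : ∑ i ∈ Finset.range p, f i = ∑ i, f i := by
    refine Finset.sum_bij' (fun i _ => (i : ZMod p)) (fun i _ => i.val) ?_ ?_ ?_ ?_ ?_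
    · simp
    · intro i _; simpa using ZMod.val_lt i
    · intro i hi; exact ZMod.val_cast_of_lt (Finset.mem_range.1 hi)
    · intro i _; exact ZMod.natCast_zmod_val i
    · intro i _; rfl
  let S := ∑ i, a i
  let c' : Fin n → ZMod 2 := c + c ∘ ⇑(g ^ p)
  have hc' : c' ∈ C := C.add_mem hc (comp_pow_mem hg p hc)
  have hc'α (k : ℕ) : c' ((g ^ k) o) = a k := by
    rw [ha]
    simp [c', α, ← Equiv.Perm.mul_apply, ← pow_add, add_comm k p]
  -- Even powers of `g` fix every point off `s`, so there `b = (1 + p) c' = 0`. On `s`, `i ↦ 2i + k`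
  -- permutes `ℤ/p`, so the sum is the constant `S`.
  let b : Fin n → ZMod 2 := c' + ∑ i ∈ Finset.range p, c' ∘ ⇑(g ^ (2 * i))
  have hb : b ∈ C := C.add_mem hc' (C.sum_mem fun i _ => comp_pow_mem hg _ hc')
  have hunit : IsUnit (2 : ZMod p) := by
    have := (ZMod.isUnit_iff_coprime 2 p).2 (Nat.coprime_two_left.2 hp)
    simpa using this
  have hbα (k : ℕ) : b ((g ^ k) o) = a k + S := by
    simp only [b, Pi.add_apply, Finset.sum_apply, Function.comp_apply, hc'α]
    congr 1
    have h1 (i : ℕ) : c' ((g ^ (2 * i)) ((g ^ k) o)) = a (hunit.unit * (i : ZMod p) + k) := by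
      rw [← Equiv.Perm.mul_apply, ← pow_add, hc'α]
      simp
    simp only [h1]
    rw [hsum fun i => a (hunit.unit * i + k)]
    exact Equiv.sum_comp (hunit.unit.mulLeft.trans (Equiv.addRight (k : ZMod p))) a
  have hb0 (y : Fin n) (hy : y ∉ s) : b y = 0 := by
    have h1 (i : ℕ) : (g ^ (2 * i)) y = y := by
      rw [pow_mul]
      exact Function.IsFixedPt.perm_pow (hfix y hy) i
    simp [b, h1, hodd, htwo]
  have hsums (f : Fin n → ZMod 2) :
      ∑ y ∈ s, f y = ∑ i ∈ Finset.range (2 * p), f ((g ^ i) o) := by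
    symm
    refine Finset.sum_nbij (fun i => (g ^ i) o) ?_ ?_ ?_ fun _ _ => rfl
    · intro i _
      exact (hs.1.perm_pow i).mapsTo ho
    · intro i hi j hj hij
      rw [hs.pow_apply_eq_pow_apply ho, hcard] at hij
      exact hij.eq_of_lt_of_lt (by simpa using hi) (by simpa using hj)
    · intro y hy
      obtain ⟨i, hi, rfl⟩ := hs.exists_pow_eq ho hy
      exact ⟨i, by simpa [hcard] using hi, rfl⟩
  have hcorr (j : ℕ) : ∑ i, (a i + S) * a (i + j) = 0 := by
    have h0 := hC.dotProduct_eq_zero hb (comp_pow_mem hg j hc)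
    rw [dotProduct, ← Finset.sum_subset (Finset.subset_univ s)
      fun y _ hy => by rw [hb0 y hy, zero_mul]] at h0
    rw [hsums] at h0
    -- `b` agrees on both halves of the cycle; folding them turns the values of `c` into pair sums.
    rw [← h0, two_mul, Finset.sum_range_add, ← Finset.sum_add_distrib, ← hsum]
    refine Finset.sum_congr rfl fun i _ => ?_
    rw [← Nat.cast_add, ha (i + j)]
    simp only [hbα, Function.comp_apply, α, ← Equiv.Perm.mul_apply, ← pow_add, Nat.cast_add,
      CharP.cast_eq_zero, zero_add, ← mul_add]
    rw [add_comm j i, show j + (p + i) = i + j + p by ring]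
  have hS : ∑ i, (a i + S) = 0 := by
    rw [Finset.sum_add_distrib]
    simp [hodd, S, htwo]
  have hv := eq_zero_of_autocorrelation_eq_zero hk hpk (fun i => a i + S) fun j => by
    have h0 := hcorr j.val
    rw [ZMod.natCast_zmod_val] at h0
    simp only [mul_add _ (a _) S]
    rw [Finset.sum_add_distrib, h0, ← Finset.sum_mul, hS, zero_mul, add_zero]
  have hconst (k : ℕ) : α k = S := by
    rw [← ha]
    exact CharTwo.add_eq_zero.1 (congrFun hv k)
  have := (hconst 0).trans (hconst 1).symm
  simpa [α, add_comm 1 p] using this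

/-- Under the assumptions of `pair_sum_eq`, with `p > 1`, the code has a word of weight at most `4`. -/
theorem IsSelfDual.exists_hammingDist_le_four (hC : C.IsSelfDual) (hg : g ∈ C.autGroup) {p k : ℕ}
    (hp : Odd p) (hp1 : 1 < p) (hk : 0 < k) (hpk : p ∣ 2 ^ k + 1) {s : Finset (Fin n)}
    (hs : g.IsCycleOn s) (hcard : s.card = 2 * p) (hfix : ∀ y ∉ s, (g ^ 2) y = y) :
    ∃ u ∈ C, u ≠ 0 ∧ hammingDist u 0 ≤ 4 := by
  obtain ⟨o, ho⟩ : s.Nonempty := Finset.card_pos.1 (by omega)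
  have hne (i : ℕ) (hi0 : 0 < i) (hi : i < 2 * p) : o ≠ (g ^ i) o := fun h =>
    Nat.not_dvd_of_pos_of_lt hi0 hi (hcard ▸ (hs.pow_apply_eq ho).1 h.symm)
  let u : Fin n → ZMod 2 := Pi.single o 1 + Pi.single ((g ^ p) o) 1 + Pi.single ((g ^ 1) o) 1 +
    Pi.single ((g ^ (p + 1)) o) 1
  refine ⟨u, hC.mem_of_forall fun c hc => ?_, fun h => ?_, ?_⟩
  · simp only [u, add_dotProduct, single_dotProduct, one_mul]
    rw [hC.pair_sum_eq hg hp hk hpk hs hcard hfix ho hc, pow_one, add_assoc]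
    exact CharTwo.add_self_eq_zero _
  · have := congrFun h o
    simp [u, Pi.single_eq_of_ne (hne p (by omega) (by omega)),
      Pi.single_eq_of_ne (pow_one g ▸ hne 1 (by omega) (by omega)),
      Pi.single_eq_of_ne (hne (p + 1) (by omega) (by omega))] at this
  · rw [hammingDist_zero_right]
    refine (Finset.card_le_card (t := {o, (g ^ p) o, (g ^ 1) o, (g ^ (p + 1)) o}) ?_).trans
      Finset.card_le_four
    intro y hy
    contrapose! hy
    simp only [Finset.mem_insert, Finset.mem_singleton, not_or] at hy
    obtain ⟨h1, h2, h3, h4⟩ := hy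
    simp [u, Pi.single_eq_of_ne h1, Pi.single_eq_of_ne h2, Pi.single_eq_of_ne h4,
      Pi.single_eq_of_ne (pow_one g ▸ h3)]

end BinaryCode

/-! ### Cycle structure of permutations of the given type -/

namespace HasTypeTwoP

variable {n p α x : ℕ} {g : Equiv.Perm (Fin n)}

theorem mem_cycleType (h : HasTypeTwoP g p α 0 x 0) (hp : p.Prime) {l : ℕ}
    (hl : l ∈ g.cycleType) : l = 2 ∨ l = 2 * p := by
  have h2 := Equiv.Perm.two_le_of_mem_cycleType hl
  have hd := Equiv.Perm.dvd_of_mem_cycleType hl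
  rw [h.order_eq] at hd
  have hlp : l ≠ p := by
    rintro rfl
    exact Multiset.count_eq_zero.1 h.p_cycles hl
  obtain ⟨a, b, ha, hb, rfl⟩ := (Nat.dvd_mul).1 hd
  rcases (Nat.dvd_prime Nat.prime_two).1 ha with rfl | rfl <;>
    rcases (Nat.dvd_prime hp).1 hb with rfl | rfl <;> simp_all

theorem eq_two_mul_add (h : HasTypeTwoP g p α 0 x 0) (hp : p.Prime) :
    n = 2 * α + 2 * p * x := by
  have hcyc : g.cycleType = Multiset.replicate α 2 + Multiset.replicate x (2 * p) := by
    ext l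
    rw [Multiset.count_add, Multiset.count_replicate, Multiset.count_replicate]
    have := hp.two_le
    by_cases h2 : l = 2
    · subst h2
      rw [h.two_cycles, if_pos rfl, if_neg (by omega), add_zero]
    by_cases h2p : l = 2 * p
    · subst h2p
      rw [h.two_p_cycles, if_pos rfl, if_neg (by omega), zero_add]
    rw [if_neg (Ne.symm h2), if_neg (Ne.symm h2p), Multiset.count_eq_zero]
    exact fun hl => (h.mem_cycleType hp hl).elim h2 h2p
  have hfix : Function.fixedPoints g = ∅ :=
    (Set.ncard_eq_zero (Set.toFinite _)).1 h.fixed_points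
  have hsupp : g.support = Finset.univ := by
    ext y
    have : y ∉ Function.fixedPoints g := by simp [hfix]
    simpa [Function.IsFixedPt] using this
  have := g.sum_cycleType
  rw [hsupp, hcyc] at this
  simp at this
  rw [← this]
  ring

/-- A point off the unique `2p`-cycle is fixed or lies in a cycle of length `2`, the only other
length available. -/
theorem exists_isCycleOn (h : HasTypeTwoP g p α 0 1 0) (hp : p.Prime) :
    ∃ s : Finset (Fin n), g.IsCycleOn s ∧ s.card = 2 * p ∧ ∀ y ∉ s, (g ^ 2) y = y := by
  have hmem : 2 * p ∈ g.cycleType := by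
    rw [← Multiset.count_pos, h.two_p_cycles]
    exact one_pos
  rw [Equiv.Perm.cycleType_def, Multiset.mem_map] at hmem
  obtain ⟨f, hf, hfc⟩ := hmem
  rw [Finset.mem_val] at hf
  have hfcard : f.support.card = 2 * p := hfc
  have hf' := Equiv.Perm.mem_cycleFactorsFinset_iff.1 hf
  refine ⟨f.support, ?_, hfcard, fun y hy => ?_⟩
  · obtain ⟨o, ho⟩ := hf'.1.nonempty_support
    rw [Equiv.Perm.cycle_is_cycleOf ho hf]
    exact Equiv.Perm.isCycleOn_support_cycleOf g o
  by_cases hgy : g y = y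
  · rw [pow_two, Equiv.Perm.mul_apply, hgy, hgy]
  have hygs : y ∈ g.support := Equiv.Perm.mem_support.2 hgy
  have hcm : g.cycleOf y ∈ g.cycleFactorsFinset :=
    Equiv.Perm.cycleOf_mem_cycleFactorsFinset_iff.2 hygs
  have hcne : g.cycleOf y ≠ f := by
    rintro rfl
    exact hy (by simpa using hgy)
  have hl : (g.cycleOf y).support.card = 2 := by
    have hl : (g.cycleOf y).support.card ∈ g.cycleType := by
      rw [Equiv.Perm.cycleType_def]
      exact Multiset.mem_map_of_mem (Finset.card ∘ Equiv.Perm.support) hcm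
    refine (h.mem_cycleType hp hl).resolve_right fun hl2 => hcne ?_
    have h1 := h.two_p_cycles
    rw [Equiv.Perm.cycleType_def, Multiset.count_map] at h1
    obtain ⟨e, he⟩ := Multiset.card_eq_one.1 h1
    have hA : g.cycleOf y ∈ ({e} : Multiset _) := by
      rw [← he]
      exact Multiset.mem_filter.2 ⟨hcm, hl2.symm⟩
    have hB : f ∈ ({e} : Multiset _) := by
      rw [← he]
      exact Multiset.mem_filter.2 ⟨hf, hfc.symm⟩
    rw [Multiset.mem_singleton.1 hA, Multiset.mem_singleton.1 hB]
  have hon := Equiv.Perm.isCycleOn_support_cycleOf g y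
  rw [hon.pow_apply_eq (by simpa using hgy), hl]

end HasTypeTwoP

theorem mainTheorem8 (m : ℕ) (C : BinaryCode (24 * m)) (hC : C.IsExtremalSelfDual)
    (p : ℕ) (hp : p.Prime) (hp2 : Odd p)
    (g : Equiv.Perm (Fin (24 * m))) (hg : g ∈ C.autGroup)
    (w x : ℕ) (htype : HasTypeTwoP g p w 0 x 0)
    (hs : Even (sOrder p)) (hw : Odd w) :
    (p : ℝ) ≤ ((24 * m : ℕ) : ℝ) / 4 - 1 := by
  have hn := htype.eq_two_mul_add hp
  have hp2' := hp.two_le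
  have hxodd : Odd x := by
    have h1 : 12 * m = w + p * x := by rw [mul_assoc] at hn; omega
    have h2 : ¬ Even x := fun hx => by
      have : Even (12 * m) := ⟨6 * m, by ring⟩
      rw [h1] at this
      exact Nat.not_even_iff_odd.2 (hw.add_even (hx.mul_left p)) this
    exact Nat.not_even_iff_odd.1 h2
  obtain ⟨y, rfl⟩ := hxodd
  have hle : 4 * p + 4 ≤ 24 * m := by
    rcases Nat.eq_zero_or_pos y with rfl | hy
    · exfalso
      obtain ⟨k, hk, hpk⟩ := exists_dvd_two_pow_add_one_of_even_sOrder hp hp2 hs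
      obtain ⟨s, hs, hcard, hfix⟩ := htype.exists_isCycleOn hp
      obtain ⟨u, hu, hu0, hu4⟩ :=
        hC.selfDual.exists_hammingDist_le_four hg hp2 hp.one_lt hk hpk hs hcard hfix
      have := hC.minDist.2 ⟨u, hu, 0, C.zero_mem, hu0, rfl⟩
      -- Minimum distance at most `4` forces `m = 0`, but `hn` makes the length positive.
      omega
    · have := Nat.mul_le_mul_left (2 * p) (show 3 ≤ 2 * y + 1 by omega)
      have := hw.pos
      have : p ≠ 2 := by rintro rfl; revert hp2; decide
      omega
  have : (4 : ℝ) * p + 4 ≤ ((24 * m : ℕ) : ℝ) := by exact_mod_cast hle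
  linarith
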